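/- \textbf{Theorem.} Let $G$ be a finite quantum group, that is, let $A=F(G)$ be a finite-dimensional unital $\mathrm{C}^*$-algebra that is also a Hopf algebra over $\mathbb{C}$ whose comultiplication $\Delta:A\to A\otimes A$ is a $*$-homomorphism; let $\varepsilon$ be its counit. A projection is an element $p\in A$ with $p=p^*=p^2$. Let $\nu$ be a state on $A$, with convolution powers $\nu^{\star 1}=\nu$, $\nu^{\star(k+1)}=(\nu\otimes\nu^{\star k})\circ\Delta$, and let $T_\nu=(\nu\otimes I_A)\circ\Delta$ be its stochastic operator. Suppose that the random walk $\nu$ is irreducible: there is no non-zero projection $q\in A$ with $\nu^{\star k}(q)=0$ for all $k\ge 1$. Let $d\ge 1$ and let $\{p_i\}_{i=0}^{d-1}\subset A$ be a $T_\nu$-cyclic partition of unity, i.e. projections with $\sum_{i=0}^{d-1}p_i=\mathds{1}_G$ (they are then automatically mutually orthogonal) such that $$T_\nu(p_iAp_i)\subseteq p_{i-1}Ap_{i-1}\qquad(i=0,\dots,d-1,\ \text{subtraction mod } d),$$ indexed so that $\varepsilon(p_0)=1$. Then $p_0$ is a group-like projection, i.e. $p_0$ is a non-zero projection with $$\Delta(p_0)(\mathds{1}_G\otimes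 p_0)=p_0\otimes p_0;$$ in other words, $p_0$ defines a quasi-subgroup of $G$. -/

import Mathlib

open scoped TensorProduct ComplexOrder

noncomputable section

/-- A finite quantum group, given by its algebra of functions `A = F(G)`: a finite-dimensional
unital C⋆-algebra that is also a Hopf algebra over `ℂ` (for the same algebra structure), whose
comultiplication `Δ : A → A ⊗ A` is a ⋆-homomorphism, `(a ⊗ b)⋆ = a⋆ ⊗ b⋆`. -/
class FiniteQuantumGroup (A : Type*) extends CStarAlgebra A, HopfAlgebra ℂ A where
  finiteDimensional : FiniteDimensional ℂ A
  comul_star : ∀ a : A, comul (Star.star a) = (Star.star (comul a) : A ⊗[ℂ] A)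

namespace FiniteQuantumGroup

variable {A : Type*} [FiniteQuantumGroup A]

/-- A state on `F(G)`: a linear functional `ν` that is positive (on the positive elements `a⋆ a`)
and satisfies `ν(1) = 1`. -/
structure IsState (ν : A →ₗ[ℂ] ℂ) : Prop where
  nonneg : ∀ a : A, 0 ≤ ν (star a * a)
  map_one : ν 1 = 1

/-- The convolution `μ ⋆ ν = (μ ⊗ ν) ∘ Δ` of linear functionals, with `ℂ ⊗ ℂ` identified
with `ℂ`. -/
def conv (μ ν : A →ₗ[ℂ] ℂ) : A →ₗ[ℂ] ℂ :=
  LinearMap.mul' ℂ ℂ ∘ₗ TensorProduct.map μ ν ∘ₗ Coalgebra.comul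

/-- The convolution powers `ν^{⋆(k+1)} = (ν ⊗ ν^{⋆k}) ∘ Δ`, started at the neutral element
`ν^{⋆0} = ε`, so that `ν^{⋆1} = ν`. -/
def convPow (ν : A →ₗ[ℂ] ℂ) : ℕ → (A →ₗ[ℂ] ℂ)
  | 0 => Coalgebra.counit
  | k + 1 => conv ν (convPow ν k)

/-- The stochastic operator `T_ν = (ν ⊗ id) ∘ Δ`, with `ℂ ⊗ F(G)` identified with `F(G)`. -/
def stochOp (ν : A →ₗ[ℂ] ℂ) : A →ₗ[ℂ] A :=
  (TensorProduct.lid ℂ A).toLinearMap ∘ₗ TensorProduct.map ν LinearMap.id ∘ₗ Coalgebra.comul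

/-- The random walk `ν` is reducible if some non-zero projection `q` satisfies
`ν^{⋆k}(q) = 0` for all `k ≥ 1`. -/
def IsReducible (ν : A →ₗ[ℂ] ℂ) : Prop :=
  ∃ q : A, IsStarProjection q ∧ q ≠ 0 ∧ ∀ k : ℕ, 1 ≤ k → convPow ν k q = 0

/-- The random walk `ν` is irreducible if it is not reducible. -/
def IsIrreducible (ν : A →ₗ[ℂ] ℂ) : Prop :=
  ¬ IsReducible ν

/-- The corner `p F(G) p`. -/
def corner (p : A) : Set A :=
  Set.range fun a : A => p * a * p

/-- A `T_ν`-cyclic partition of unity, indexed modulo `d ≥ 1`: projections `p_i` that sum to `1`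
(which makes them mutually orthogonal), such that `T_ν` maps the corner `p_i F(G) p_i` into
the corner `p_{i-1} F(G) p_{i-1}`. -/
structure IsCyclicPartition (ν : A →ₗ[ℂ] ℂ) {d : ℕ} [NeZero d] (p : ZMod d → A) : Prop where
  isStarProjection : ∀ i, IsStarProjection (p i)
  sum_eq_one : ∑ i, p i = 1
  mapsTo : ∀ i, Set.MapsTo (stochOp ν) (corner (p i)) (corner (p (i - 1)))

/-- A group-like projection: a non-zero projection with `Δ(p)(1 ⊗ p) = p ⊗ p`. Quasi-subgroups
of `G` are by definition the virtual objects given by group-like projections. -/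
structure IsGroupLikeProjection (p : A) : Prop where
  isStarProjection : IsStarProjection p
  ne_zero : p ≠ 0
  comul_mul : (Coalgebra.comul p : A ⊗[ℂ] A) * ((1 : A) ⊗ₜ[ℂ] p) = p ⊗ₜ[ℂ] p

end FiniteQuantumGroup

end

/-! Put `w = (Δ(p₀) - p₀ ⊗ 1)(1 ⊗ p₀)`; the claim is `w = 0`. Every non-zero left ideal contains a
non-zero projection, so by Cauchy–Schwarz irreducibility makes the powers `ν^{⋆k}`, `k ≥ 1`, jointly
faithful; factoring Gram matrices carries this over to slices
(`IsIrreducible.eq_zero_of_sliceLeft`). It remains to see that each `(ν^{⋆k} ⊗ id)(w⋆ w)` vanishes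
(`sliceLeft_convPow_eq_zero`).

Since `T_ν` shifts the `p i`, the slice of `Δ(p₀)` is `p (-k)`, and `ν^{⋆k}(p₀)` is 1 if `d ∣ k` and
0 otherwise. In the first case `p₀ ⊗ 1` acts as `1` under the slice, leaving `p₀(1 - p₀)p₀`; in the
second it acts as `0`, leaving `p₀ p (-k) p₀`. Both are zero. -/

noncomputable section

/-! ### Projections and positive functionals on C⋆-algebras -/

section CStarAlgebra

variable {A : Type*} [CStarAlgebra A]

/-- In a C⋆-algebra, a finite sum of elements `c⋆ c` vanishes only if every summand does. -/
theorem eq_zero_of_sum_star_mul_self_eq_zero {ι : Type*} (s : Finset ι) (c : ι → A)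
    (h : ∑ i ∈ s, star (c i) * c i = 0) : ∀ i ∈ s, c i = 0 := by
  let _ := CStarAlgebra.spectralOrder A
  have := CStarAlgebra.spectralOrderedRing A
  intro i hi
  rw [Finset.sum_eq_zero_iff_of_nonneg fun i _ => star_mul_self_nonneg (c i)] at h
  exact CStarRing.star_mul_self_eq_zero_iff (c i) |>.1 (h i hi)

/-- Projections that sum to `1` are mutually orthogonal. -/
theorem IsStarProjection.mul_eq_zero_of_sum_eq_one {ι : Type*} [Fintype ι] {p : ι → A}
    (hp : ∀ i, IsStarProjection (p i)) (hsum : ∑ i, p i = 1) {i j : ι} (hij : i ≠ j) :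
    p i * p j = 0 := by
  classical
  -- The sum is `p j (1 - p j) p j`.
  have key : ∑ k ∈ Finset.univ.erase j, star (p k * p j) * (p k * p j) = 0 := by
    have h1 : ∀ k, star (p k * p j) * (p k * p j) = p j * p k * p j := fun k => by
      rw [star_mul, (hp k).isSelfAdjoint.star_eq, (hp j).isSelfAdjoint.star_eq, mul_assoc,
        ← mul_assoc (p k), (hp k).isIdempotentElem.eq, mul_assoc]
    have h2 : ∑ k, p j * p k * p j = p j := by
      rw [← Finset.sum_mul, ← Finset.mul_sum, hsum, mul_one, (hp j).isIdempotentElem.eq]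
    rw [← Finset.add_sum_erase _ _ (Finset.mem_univ j), (hp j).isIdempotentElem.eq,
      (hp j).isIdempotentElem.eq] at h2
    rwa [Finset.sum_congr rfl fun k _ => h1 k, ← add_eq_left]
  exact eq_zero_of_sum_star_mul_self_eq_zero _ _ key i (Finset.mem_erase.2 ⟨hij, Finset.mem_univ i⟩)

/-- In a finite-dimensional C⋆-algebra, every non-zero element has a left multiple that is a
non-zero projection. -/
theorem exists_mul_isStarProjection [FiniteDimensional ℂ A] {a : A} (ha : a ≠ 0) :
    ∃ c : A, IsStarProjection (c * a) ∧ c * a ≠ 0 := by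
  set b := star a * a with hb
  have hbs : IsSelfAdjoint b := .star_mul_self a
  have hfinC : (spectrum ℂ b).Finite := by
    have hm : minpoly ℂ b ≠ 0 := minpoly.ne_zero (Algebra.IsIntegral.isIntegral b)
    refine (minpoly ℂ b).roots.toFinset.finite_toSet.subset fun x hx => ?_
    have hn : Nontrivial A := ⟨a, 0, ha⟩
    have := spectrum.subset_polynomial_aeval b (minpoly ℂ b) ⟨x, hx, rfl⟩
    rw [minpoly.aeval, spectrum.zero_eq] at this
    simpa [hm] using this
  have hfin : (spectrum ℝ b).Finite := by
    refine (hfinC.preimage Complex.ofReal_injective.injOn).subset fun x hx => ?_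
    simpa using spectrum.algebraMap_mem ℂ hx
  -- Finite spectrum makes the functional calculus available for `x⁻¹`, even at `0`.
  have hcont : ∀ f : ℝ → ℝ, ContinuousOn f (spectrum ℝ b) := fun f => hfin.continuousOn f
  -- As `0⁻¹ = 0`, this is the indicator of `x ≠ 0`: the support projection of `b`.
  have hq : cfc (fun x : ℝ => x⁻¹ * x) b = cfc (fun x : ℝ => x⁻¹) b * star a * a := by
    rw [cfc_mul _ _ b (hcont _) (hcont _), cfc_id' ℝ b, mul_assoc]
  refine ⟨cfc (fun x : ℝ => x⁻¹) b * star a, ?_, ?_⟩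
  · rw [← hq]
    refine ⟨?_, cfc_predicate _ b⟩
    rw [IsIdempotentElem, ← cfc_mul _ _ b (hcont _) (hcont _)]
    congr 1
    ext x
    by_cases hx : x = 0 <;> simp [hx]
  · intro h
    refine ha (CStarRing.star_mul_self_eq_zero_iff a |>.1 ?_)
    calc star a * a = cfc (fun x : ℝ => x * (x⁻¹ * x)) b := by
          rw [← hb]
          conv_lhs => rw [← cfc_id' ℝ b]
          congr 1
          ext x
          by_cases hx : x = 0 <;> simp [hx]
      _ = b * cfc (fun x : ℝ => x⁻¹ * x) b := by
          rw [cfc_mul _ _ b (hcont _) (hcont _), cfc_id' ℝ b]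
      _ = 0 := by rw [hq, h, mul_zero]

/-- A linear functional on a C⋆-algebra is positive if it is non-negative on all `a⋆ a`. -/
def IsPositiveFunctional (μ : A →ₗ[ℂ] ℂ) : Prop :=
  ∀ a : A, 0 ≤ μ (star a * a)

namespace IsPositiveFunctional

variable {μ : A →ₗ[ℂ] ℂ}

theorem map_star (hμ : IsPositiveFunctional μ) (a : A) : μ (star a) = star (μ a) := by
  let _ := CStarAlgebra.spectralOrder A
  have := CStarAlgebra.spectralOrderedRing A
  have hpos : ∀ x : A, 0 ≤ x → 0 ≤ μ x := fun x hx => by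
    obtain ⟨b, rfl⟩ := CStarAlgebra.nonneg_iff_eq_star_mul_self.1 hx
    exact hμ b
  exact StarHomClass.map_star (PositiveLinearMap.mk₀ μ hpos) a

theorem posSemidef_gram (hμ : IsPositiveFunctional μ) {ι : Type*} [Fintype ι] (a : ι → A) :
    (Matrix.of fun i j => μ (star (a i) * a j)).PosSemidef := by
  rw [Matrix.posSemidef_iff_dotProduct_mulVec]
  refine ⟨?_, fun x => ?_⟩
  · ext i j
    simp [← hμ.map_star]
  · convert hμ (∑ i, x i • a i) using 1
    simp only [dotProduct, Matrix.mulVec, Matrix.of_apply, star_sum, star_smul, Finset.sum_mul,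
      Finset.mul_sum, map_sum, Pi.star_apply, smul_mul_assoc, mul_smul_comm, map_smul, smul_eq_mul]
    rw [Finset.sum_comm]
    exact Finset.sum_congr rfl fun i _ => Finset.sum_congr rfl fun j _ => by ring

/-- If `μ(a⋆ a) = 0` then `μ(c a) = 0` for all `c`. -/
theorem map_mul_eq_zero (hμ : IsPositiveFunctional μ) {a : A} (ha : μ (star a * a) = 0) (c : A) :
    μ (c * a) = 0 := by
  let _ := CStarAlgebra.spectralOrder A
  have := CStarAlgebra.spectralOrderedRing A
  have hpos : ∀ x : A, 0 ≤ x → 0 ≤ μ x := fun x hx => by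
    obtain ⟨b, rfl⟩ := CStarAlgebra.nonneg_iff_eq_star_mul_self.1 hx
    exact hμ b
  let f := PositiveLinearMap.mk₀ μ hpos
  -- Cauchy–Schwarz for the GNS form of `μ`.
  have h := norm_inner_le_norm (𝕜 := ℂ) (f.toPreGNS (star c)) (f.toPreGNS a)
  have h0 : ‖f.toPreGNS a‖ = 0 := by
    rw [PositiveLinearMap.preGNS_norm_def]
    change √(μ (star a * a)).re = 0
    simp [ha]
  rw [h0, mul_zero, PositiveLinearMap.preGNS_inner_def] at h
  have h2 : ‖μ (star (star c) * a)‖ ≤ 0 := h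
  simpa using h2

theorem map_mul_isStarProjection (hμ : IsPositiveFunctional μ) {q : A} (hq : IsStarProjection q)
    (h : μ q = 0) (c : A) : μ (c * q) = 0 :=
  hμ.map_mul_eq_zero (by rw [hq.isSelfAdjoint.star_eq, hq.isIdempotentElem.eq, h]) c

/-- A positive semidefinite Gram matrix is of the form `Bᴴ B`. -/
theorem exists_gram_eq (hμ : IsPositiveFunctional μ) {ι : Type*} [Fintype ι] (a : ι → A) :
    ∃ B : Matrix ι ι ℂ, ∀ i j, μ (star (a i) * a j) = ∑ k, star (B k i) * B k j := by
  classical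
  open scoped MatrixOrder in
  obtain ⟨B, hB⟩ := CStarAlgebra.nonneg_iff_eq_star_mul_self.1 (hμ.posSemidef_gram a).nonneg
  exact ⟨B, fun i j => congr_fun (congr_fun hB i) j⟩

end IsPositiveFunctional

/-! ### Slices by positive functionals -/

/-- The slice map `μ ⊗ id : A ⊗ A → A`. -/
def sliceLeft (μ : A →ₗ[ℂ] ℂ) : A ⊗[ℂ] A →ₗ[ℂ] A :=
  (TensorProduct.lid ℂ A).toLinearMap ∘ₗ TensorProduct.map μ LinearMap.id

variable (μ : A →ₗ[ℂ] ℂ)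

@[simp]
theorem sliceLeft_tmul (a b : A) : sliceLeft μ (a ⊗ₜ b) = μ a • b := by
  simp [sliceLeft]

theorem sliceLeft_mul_one_tmul (w : A ⊗[ℂ] A) (b : A) :
    sliceLeft μ (w * (1 ⊗ₜ b)) = sliceLeft μ w * b := by
  induction w with
  | zero => simp
  | tmul x y => simp
  | add x y hx hy => simp [add_mul, hx, hy]

theorem sliceLeft_one_tmul_mul (w : A ⊗[ℂ] A) (b : A) :
    sliceLeft μ ((1 ⊗ₜ b) * w) = b * sliceLeft μ w := by
  induction w with
  | zero => simp
  | tmul x y => simp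
  | add x y hx hy => simp [mul_add, hx, hy]

variable {μ}

theorem sliceLeft_mul_tmul_one_eq_zero {q : A} (h : ∀ c, μ (c * q) = 0) (w : A ⊗[ℂ] A) :
    sliceLeft μ (w * (q ⊗ₜ 1)) = 0 := by
  induction w with
  | zero => simp
  | tmul x y => simp [h]
  | add x y hx hy => simp [add_mul, hx, hy]

theorem sliceLeft_tmul_one_mul_eq_zero {q : A} (h : ∀ c, μ (q * c) = 0) (w : A ⊗[ℂ] A) :
    sliceLeft μ ((q ⊗ₜ 1) * w) = 0 := by
  induction w with
  | zero => simp
  | tmul x y => simp [h]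
  | add x y hx hy => simp [mul_add, hx, hy]

/-- The slice is a form in the `b i` with the Gram matrix as coefficients, so a factorization `Bᴴ B`
splits it into squares. -/
theorem sliceLeft_star_mul_self {ι : Type*} [Fintype ι] (a b : ι → A) {B : Matrix ι ι ℂ}
    (hB : ∀ i j, μ (star (a i) * a j) = ∑ k, star (B k i) * B k j) :
    sliceLeft μ (star (∑ i, a i ⊗ₜ[ℂ] b i) * ∑ i, a i ⊗ₜ[ℂ] b i) =
      ∑ k, star (∑ i, B k i • b i) * ∑ i, B k i • b i := by
  have h1 : ∀ k, star (∑ i, B k i • b i) * ∑ i, B k i • b i =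
      ∑ i, ∑ j, (star (B k i) * B k j) • (star (b i) * b j) := fun k => by
    rw [star_sum, Finset.sum_mul_sum]
    simp only [star_smul, smul_mul_smul_comm]
  rw [star_sum, Finset.sum_mul_sum]
  simp only [h1, TensorProduct.star_tmul, map_sum, Algebra.TensorProduct.tmul_mul_tmul,
    sliceLeft_tmul, hB, Finset.sum_smul]
  refine .trans (Finset.sum_congr rfl fun i _ => Finset.sum_comm) Finset.sum_comm

/-- The slice of `w⋆ w` by a positive functional is a sum of elements `c⋆ c`. -/
theorem IsPositiveFunctional.exists_sliceLeft_eq_sum (hμ : IsPositiveFunctional μ)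
    [FiniteDimensional ℂ A] (w : A ⊗[ℂ] A) :
    ∃ (n : ℕ) (c : Fin n → A), sliceLeft μ (star w * w) = ∑ k, star (c k) * c k := by
  obtain ⟨a, rfl⟩ := TensorProduct.eq_repr_basis_right (Module.finBasis ℂ A) w
  rw [Finsupp.sum_fintype _ _ (by simp)]
  obtain ⟨B, hB⟩ := hμ.exists_gram_eq a
  exact ⟨_, _, sliceLeft_star_mul_self _ _ hB⟩

/-- If the slice of `w⋆ w` by a positive functional `μ` vanishes, then the coefficients of `w`
with respect to a basis of the second leg lie in the left kernel of `μ`. -/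
theorem IsPositiveFunctional.map_star_mul_self_eq_zero_of_sliceLeft (hμ : IsPositiveFunctional μ)
    {ι : Type*} [Fintype ι] (𝓑 : Module.Basis ι ℂ A) (a : ι → A)
    (h : sliceLeft μ (star (∑ i, a i ⊗ₜ[ℂ] 𝓑 i) * ∑ i, a i ⊗ₜ[ℂ] 𝓑 i) = 0) (i : ι) :
    μ (star (a i) * a i) = 0 := by
  obtain ⟨B, hB⟩ := hμ.exists_gram_eq a
  rw [sliceLeft_star_mul_self _ _ hB] at h
  have hc := eq_zero_of_sum_star_mul_self_eq_zero _ _ h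
  -- Each square vanishes, so linear independence kills the coefficients.
  have hB0 : ∀ k, B k i = 0 := fun k =>
    Fintype.linearIndependent_iff.1 𝓑.linearIndependent (B k) (hc k (Finset.mem_univ k)) i
  simp [hB, hB0]

end CStarAlgebra

/-! ### Convolution powers and joint faithfulness -/

namespace FiniteQuantumGroup

variable {A : Type*} [FiniteQuantumGroup A]

theorem stochOp_apply (μ : A →ₗ[ℂ] ℂ) (a : A) :
    stochOp μ a = sliceLeft μ (Coalgebra.comul a) := rfl

theorem isPositiveFunctional_counit :
    IsPositiveFunctional (Coalgebra.counit : A →ₗ[ℂ] ℂ) := fun a => by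
  have h : (Bialgebra.counitAlgHom ℂ A) (star a) = star (Bialgebra.counitAlgHom ℂ A a) :=
    -- Characters of a C⋆-algebra preserve the star.
    have := AlgHomClass.instStarHomClass (F := A →ₐ[ℂ] ℂ) (A := A)
    StarHomClass.map_star (Bialgebra.counitAlgHom ℂ A) a
  have h' : Coalgebra.counit (R := ℂ) (star a) = star (Coalgebra.counit (R := ℂ) a) := h
  rw [Bialgebra.counit_mul, h']
  exact star_mul_self_nonneg _

/-- `μ ⋆ ν = ν ∘ T_μ`. -/
theorem conv_eq_comp_stochOp (μ ν : A →ₗ[ℂ] ℂ) : conv μ ν = ν ∘ₗ stochOp μ := by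
  have h : LinearMap.mul' ℂ ℂ ∘ₗ TensorProduct.map μ ν = ν ∘ₗ sliceLeft μ := by
    ext a b
    simp
  rw [conv, ← LinearMap.comp_assoc, h]
  rfl

theorem isPositiveFunctional_conv {μ ν : A →ₗ[ℂ] ℂ} (hμ : IsPositiveFunctional μ)
    (hν : IsPositiveFunctional ν) : IsPositiveFunctional (conv μ ν) := fun a => by
  have := FiniteQuantumGroup.finiteDimensional (A := A)
  obtain ⟨n, c, hc⟩ := hμ.exists_sliceLeft_eq_sum (Coalgebra.comul a)
  rw [conv_eq_comp_stochOp, LinearMap.comp_apply, stochOp_apply, Bialgebra.comul_mul,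
    comul_star, hc, map_sum]
  exact Finset.sum_nonneg fun k _ => hν _

theorem isPositiveFunctional_convPow {ν : A →ₗ[ℂ] ℂ} (hν : IsPositiveFunctional ν) (k : ℕ) :
    IsPositiveFunctional (convPow ν k) := by
  induction k with
  | zero => exact isPositiveFunctional_counit
  | succ k ih => exact isPositiveFunctional_conv hν ih

theorem stochOp_counit (a : A) : stochOp Coalgebra.counit a = a := by
  have h := congrArg (TensorProduct.lid ℂ A) (Coalgebra.rTensor_counit_comul (R := ℂ) a)
  rw [TensorProduct.lid_tmul, one_smul] at h
  exact h

/-- `T_{μ ⋆ ν} = T_ν T_μ`. -/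
theorem stochOp_conv (μ ν : A →ₗ[ℂ] ℂ) (a : A) :
    stochOp (conv μ ν) a = stochOp ν (stochOp μ a) := by
  have h1 : sliceLeft (conv μ ν) =
      sliceLeft ν ∘ₗ TensorProduct.map (stochOp μ) LinearMap.id := by
    ext a b
    simp [conv_eq_comp_stochOp]
  have h2 : TensorProduct.map (stochOp μ) LinearMap.id = TensorProduct.map (sliceLeft μ) .id ∘ₗ
      LinearMap.rTensor A (Coalgebra.comul (R := ℂ) (A := A)) := by
    ext a b
    rfl
  have h3 : TensorProduct.map (sliceLeft μ) .id =
      (TensorProduct.lid ℂ (A ⊗[ℂ] A)).toLinearMap ∘ₗ TensorProduct.map μ .id ∘ₗ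
        (TensorProduct.assoc ℂ A A A).toLinearMap := by
    ext a b c
    simp [TensorProduct.smul_tmul']
  have h4 : (TensorProduct.lid ℂ (A ⊗[ℂ] A)).toLinearMap ∘ₗ TensorProduct.map μ .id ∘ₗ
      LinearMap.lTensor A (Coalgebra.comul (R := ℂ) (A := A)) =
      Coalgebra.comul (R := ℂ) (A := A) ∘ₗ sliceLeft μ := by
    ext a b
    simp
  have h5 : TensorProduct.map (stochOp μ) LinearMap.id (Coalgebra.comul a) =
      Coalgebra.comul (R := ℂ) (A := A) (sliceLeft μ (Coalgebra.comul a)) := by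
    rw [h2, h3, ← LinearMap.comp_apply Coalgebra.comul, ← h4]
    simp only [LinearMap.comp_apply, LinearEquiv.coe_coe]
    rw [Coalgebra.coassoc_apply]
  rw [stochOp_apply, h1, LinearMap.comp_apply, h5]
  rfl

/-- The convolution powers of an irreducible random walk are jointly faithful. -/
theorem IsIrreducible.eq_zero {ν : A →ₗ[ℂ] ℂ} (hirr : IsIrreducible ν)
    (hν : IsPositiveFunctional ν) {a : A}
    (ha : ∀ k, 1 ≤ k → convPow ν k (star a * a) = 0) : a = 0 := by
  have := FiniteQuantumGroup.finiteDimensional (A := A)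
  by_contra ha0
  obtain ⟨c, hc, hc0⟩ := exists_mul_isStarProjection ha0
  exact hirr ⟨c * a, hc, hc0, fun k hk =>
    (isPositiveFunctional_convPow hν k).map_mul_eq_zero (ha k hk) c⟩

/-- If the random walk is irreducible, then an element `w` of `A ⊗ A` vanishes as soon as
`(ν^{⋆k} ⊗ id)(w⋆ w) = 0` for all `k ≥ 1`. -/
theorem IsIrreducible.eq_zero_of_sliceLeft {ν : A →ₗ[ℂ] ℂ} (hirr : IsIrreducible ν)
    (hν : IsPositiveFunctional ν) {w : A ⊗[ℂ] A}
    (hw : ∀ k, 1 ≤ k → sliceLeft (convPow ν k) (star w * w) = 0) : w = 0 := by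
  have := FiniteQuantumGroup.finiteDimensional (A := A)
  let 𝓑 := Module.finBasis ℂ A
  obtain ⟨a, rfl⟩ := TensorProduct.eq_repr_basis_right 𝓑 w
  rw [Finsupp.sum_fintype _ _ (by simp)] at hw ⊢
  have ha : ∀ i, a i = 0 := fun i => hirr.eq_zero hν fun k hk =>
    (isPositiveFunctional_convPow hν k).map_star_mul_self_eq_zero_of_sliceLeft 𝓑 a (hw k hk) i
  simp [ha]

/-! ### Cyclic partitions of unity -/

namespace IsCyclicPartition

variable {ν : A →ₗ[ℂ] ℂ} {d : ℕ} [NeZero d] {p : ZMod d → A}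

theorem mul_eq_zero (hp : IsCyclicPartition ν p) {i j : ZMod d} (hij : i ≠ j) :
    p i * p j = 0 :=
  IsStarProjection.mul_eq_zero_of_sum_eq_one hp.isStarProjection hp.sum_eq_one hij

theorem stochOp_one (hν : ν 1 = 1) : stochOp ν 1 = 1 := by
  rw [stochOp_apply, Bialgebra.comul_one, Algebra.TensorProduct.one_def, sliceLeft_tmul, hν,
    one_smul]

/-- The stochastic operator permutes the projections of a cyclic partition of unity. -/
theorem stochOp_apply_eq (hp : IsCyclicPartition ν p) (hν : ν 1 = 1) (i : ZMod d) :
    stochOp ν (p i) = p (i - 1) := by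
  have hT : ∀ j, ∃ a, p (j - 1) * a * p (j - 1) = stochOp ν (p j) := fun j =>
    hp.mapsTo j ⟨1, by simp [(hp.isStarProjection j).isIdempotentElem.eq]⟩
  -- Orthogonality leaves only the term `j = i`.
  have h1 : ∑ j, p (i - 1) * stochOp ν (p j) = p (i - 1) := by
    rw [← Finset.mul_sum, ← map_sum, hp.sum_eq_one, stochOp_one hν, mul_one]
  rw [← h1, Finset.sum_eq_single i]
  · obtain ⟨a, ha⟩ := hT i
    rw [← ha, ← mul_assoc, ← mul_assoc, (hp.isStarProjection _).isIdempotentElem.eq]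
  · intro j _ hj
    obtain ⟨a, ha⟩ := hT j
    have : i - 1 ≠ j - 1 := fun h => hj (sub_left_injective h).symm
    rw [← ha, ← mul_assoc, ← mul_assoc, hp.mul_eq_zero this, zero_mul, zero_mul]
  · simp

theorem stochOp_convPow_apply (hp : IsCyclicPartition ν p) (hν : ν 1 = 1) (k : ℕ) (i : ZMod d) :
    stochOp (convPow ν k) (p i) = p (i - k) := by
  induction k generalizing i with
  | zero => simp [convPow, stochOp_counit]
  | succ k ih =>
    rw [convPow, stochOp_conv, hp.stochOp_apply_eq hν, ih]
    push_cast
    congr 1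
    ring

theorem counit_eq_zero (hp : IsCyclicPartition ν p)
    (hε : Coalgebra.counit (R := ℂ) (p 0) = 1) {i : ZMod d} (hi : i ≠ 0) :
    Coalgebra.counit (R := ℂ) (p i) = 0 := by
  have h := congrArg (Coalgebra.counit (R := ℂ)) (hp.mul_eq_zero hi)
  rwa [Bialgebra.counit_mul, hε, mul_one, map_zero] at h

theorem convPow_apply (hp : IsCyclicPartition ν p) (hν : ν 1 = 1) (k : ℕ) (i : ZMod d) :
    convPow ν k (p i) = Coalgebra.counit (R := ℂ) (p (i - k)) := by
  induction k generalizing i with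
  | zero => simp [convPow]
  | succ k ih =>
    rw [convPow, conv_eq_comp_stochOp, LinearMap.comp_apply, hp.stochOp_apply_eq hν, ih]
    push_cast
    congr 2
    ring

/-- The slices of `w⋆ w` by the convolution powers of `ν` vanish for
`w = (Δ(p₀) - p₀ ⊗ 1)(1 ⊗ p₀)`. -/
theorem sliceLeft_convPow_eq_zero (hp : IsCyclicPartition ν p) (hν : IsState ν)
    (hε : Coalgebra.counit (R := ℂ) (p 0) = 1) (k : ℕ) :
    sliceLeft (convPow ν k)
      (star ((Coalgebra.comul (p 0) - p 0 ⊗ₜ[ℂ] 1) * ((1 : A) ⊗ₜ[ℂ] p 0)) *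
        ((Coalgebra.comul (p 0) - p 0 ⊗ₜ[ℂ] 1) * ((1 : A) ⊗ₜ[ℂ] p 0))) = 0 := by
  have hμ := isPositiveFunctional_convPow hν.nonneg k
  have hP := hp.isStarProjection 0
  have hΔ : Coalgebra.comul (R := ℂ) (p 0) * Coalgebra.comul (R := ℂ) (p 0) =
      Coalgebra.comul (R := ℂ) (p 0) := by
    rw [← Bialgebra.comul_mul, hP.isIdempotentElem.eq]
  have hpp : (p 0 ⊗ₜ[ℂ] (1 : A)) * (p 0 ⊗ₜ[ℂ] (1 : A)) = p 0 ⊗ₜ[ℂ] (1 : A) := by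
    simp [hP.isIdempotentElem.eq]
  have hstar : star ((Coalgebra.comul (p 0) - p 0 ⊗ₜ[ℂ] 1) * ((1 : A) ⊗ₜ[ℂ] p 0)) =
      (1 ⊗ₜ[ℂ] p 0) * (Coalgebra.comul (p 0) - p 0 ⊗ₜ[ℂ] (1 : A)) := by
    rw [star_mul, star_sub, ← comul_star, TensorProduct.star_tmul, TensorProduct.star_tmul,
      hP.isSelfAdjoint.star_eq, star_one]
  rw [hstar, mul_assoc, ← mul_assoc (_ - _) (_ - _), sliceLeft_one_tmul_mul,
    sliceLeft_mul_one_tmul]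
  have hE : sliceLeft (convPow ν k) (Coalgebra.comul (p 0)) = p (-k) := by
    rw [← stochOp_apply, hp.stochOp_convPow_apply hν.map_one, zero_sub]
  have hleft : ∀ {q : A}, IsStarProjection q → convPow ν k q = 0 →
      ∀ c, convPow ν k (q * c) = 0 := fun {q} hq h c => by
    have := hμ.map_star (star c * q)
    rw [star_mul, star_star, hq.isSelfAdjoint.star_eq] at this
    rw [this, hμ.map_mul_isStarProjection hq h, star_zero]
  by_cases hk : (-k : ZMod d) = 0
  · have h0 : convPow ν k (1 - p 0) = 0 := by
      have h1 : convPow ν k 1 = 1 := by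
        rw [← hp.sum_eq_one, map_sum,
          Finset.sum_congr rfl fun i _ => hp.convPow_apply hν.map_one k i]
        simp_rw [sub_eq_add_neg, hk, add_zero]
        rw [← map_sum, hp.sum_eq_one, Bialgebra.counit_one]
      rw [map_sub, h1, hp.convPow_apply hν.map_one, zero_sub, hk, hε, sub_self]
    have hr := sliceLeft_mul_tmul_one_eq_zero
      (hμ.map_mul_isStarProjection hP.one_sub h0) (Coalgebra.comul (p 0))
    have hl := sliceLeft_tmul_one_mul_eq_zero (hleft hP.one_sub h0) (Coalgebra.comul (p 0))
    have h2 : convPow ν k (p 0) = 1 := by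
      rw [hp.convPow_apply hν.map_one, zero_sub, hk, hε]
    rw [TensorProduct.sub_tmul, ← Algebra.TensorProduct.one_def,
      mul_sub, mul_one, map_sub, sub_eq_zero] at hr
    rw [TensorProduct.sub_tmul, ← Algebra.TensorProduct.one_def,
      sub_mul, one_mul, map_sub, sub_eq_zero] at hl
    -- The four slices are `p 0`, `p 0`, `p 0` and `1`, combining to `1 - p 0`.
    rw [sub_mul, mul_sub, mul_sub, hΔ, hpp, map_sub, map_sub, map_sub, ← hr, ← hl, hE, hk,
      sliceLeft_tmul, h2, one_smul]
    simp [sub_mul, hP.isIdempotentElem.eq]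
  · have h0 : convPow ν k (p 0) = 0 := by
      rw [hp.convPow_apply hν.map_one, zero_sub, hp.counit_eq_zero hε hk]
    have hr := sliceLeft_mul_tmul_one_eq_zero
      (hμ.map_mul_isStarProjection hP h0) (Coalgebra.comul (p 0))
    have hl := sliceLeft_tmul_one_mul_eq_zero (hleft hP h0) (Coalgebra.comul (p 0))
    rw [sub_mul, mul_sub, mul_sub, hΔ, hpp, map_sub, map_sub, map_sub, hr, hl, hE,
      sliceLeft_tmul, h0, zero_smul, sub_zero, sub_zero, sub_zero, hp.mul_eq_zero hk, mul_zero]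

end IsCyclicPartition

end FiniteQuantumGroup
end

theorem mainTheorem3 {A : Type*} [FiniteQuantumGroup A]
    (ν : A →ₗ[ℂ] ℂ) (hν : FiniteQuantumGroup.IsState ν)
    (hirr : FiniteQuantumGroup.IsIrreducible ν)
    {d : ℕ} [NeZero d] (p : ZMod d → A)
    (hp : FiniteQuantumGroup.IsCyclicPartition ν p)
    (hε : Coalgebra.counit (R := ℂ) (p 0) = 1) :
    FiniteQuantumGroup.IsGroupLikeProjection (p 0) where
  isStarProjection := hp.isStarProjection 0
  ne_zero h := by simp [h] at hε
  comul_mul := by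
    have h := hirr.eq_zero_of_sliceLeft hν.nonneg fun k _ => hp.sliceLeft_convPow_eq_zero hν hε k
    rw [sub_mul, sub_eq_zero] at h
    simpa using h
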